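/- Let $X$ be a nonempty proper CAT(0) space and let $G$ be a group acting geometrically on $X$, i.e. by isometries, properly (for every compact $K\subseteq X$ the set $\{g\in G: gK\cap K\ne\emptyset\}$ is finite) and cocompactly ($X/G$ is compact). Let $\partial X$ be the visual boundary of $X$, the set of geodesic rays $[0,\infty)\to X$ modulo the relation that identifies two rays $\alpha,\beta$ when $d(\alpha(t),\beta(t))$ is bounded, with the induced action of $G$. Call a subgroup $H\le G$ convex if there is a nonempty closed convex subset $Y\subseteq X$ with $HY=Y$ on which $H$ acts geometrically. For $H\le G$ let $Z_H=\{g\in G: gh=hg \text{ for all } h\in H\}$ be its centralizer. Let $A\subseteq\partial X$, and let $\mathrm{Fix}(A)=\{g\in G: g\alpha=\alpha \text{ for all } \alpha\in A\}$. If $H=\mathrm{Fix}(A)$ is finitely generated, then $H$ is a convex subgroup of $G$, and $H=Z_{Z_H}$. -/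

import Mathlib

/-- `γ` restricted to `[0, dist x y]` is a geodesic (an isometric embedding of an interval)
from `x` to `y`. -/
structure IsGeodesicSegment {X : Type*} [MetricSpace X] (γ : ℝ → X) (x y : X) : Prop where
  dist_eq : ∀ s ∈ Set.Icc 0 (dist x y), ∀ t ∈ Set.Icc 0 (dist x y), dist (γ s) (γ t) = |s - t|
  source : γ 0 = x
  target : γ (dist x y) = y

/-- A CAT(0) space: a geodesic metric space all of whose geodesic triangles are CAT(0). The triangle
has vertices `p i` and sides `γ i` from `p i` to `p (i + 1)` (indices mod 3), the comparison
triangle in the Euclidean plane has vertices `q i`, and `u`, `v` are the comparison points of the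
points `γ i s`, `γ j t`. -/
structure IsCAT0 (X : Type*) [MetricSpace X] : Prop where
  exists_geodesic : ∀ x y : X, ∃ γ : ℝ → X, IsGeodesicSegment γ x y
  dist_le_comparison : ∀ (p : Fin 3 → X) (γ : Fin 3 → ℝ → X),
    (∀ i, IsGeodesicSegment (γ i) (p i) (p (i + 1))) →
    ∀ q : Fin 3 → EuclideanSpace ℝ (Fin 2), (∀ i j, dist (q i) (q j) = dist (p i) (p j)) →
    ∀ i j : Fin 3, ∀ s ∈ Set.Icc 0 (dist (p i) (p (i + 1))),
    ∀ t ∈ Set.Icc 0 (dist (p j) (p (j + 1))),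
    ∀ u ∈ segment ℝ (q i) (q (i + 1)), ∀ v ∈ segment ℝ (q j) (q (j + 1)),
    dist (q i) u = s → dist (q j) v = t → dist (γ i s) (γ j t) ≤ dist u v

/-- A subset is (geodesically) convex if it contains every geodesic segment between its points. -/
def IsGeodesicallyConvex {X : Type*} [MetricSpace X] (Y : Set X) : Prop :=
  ∀ x ∈ Y, ∀ y ∈ Y, ∀ γ : ℝ → X, IsGeodesicSegment γ x y →
    ∀ t ∈ Set.Icc 0 (dist x y), γ t ∈ Y

/-- Geodesic rays `[0, ∞) → X`. -/
def GeodesicRay (X : Type*) [MetricSpace X] : Type _ :=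
  {α : NNReal → X // Isometry α}

/-- Two rays are equivalent if they stay at bounded distance from each other. -/
instance GeodesicRay.setoid (X : Type*) [MetricSpace X] : Setoid (GeodesicRay X) where
  r α β := ∃ C : ℝ, ∀ t, dist (α.1 t) (β.1 t) ≤ C
  iseqv :=
    { refl := fun α => ⟨0, fun t => by simp⟩
      symm := fun ⟨C, hC⟩ => ⟨C, fun t => by rw [dist_comm]; exact hC t⟩
      trans := fun ⟨C, hC⟩ ⟨D, hD⟩ =>
        ⟨C + D, fun t => (dist_triangle _ _ _).trans (add_le_add (hC t) (hD t))⟩ }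

/-- The (visual) boundary of `X`, as a set: geodesic rays up to bounded distance. -/
def VisualBoundary (X : Type*) [MetricSpace X] : Type _ :=
  Quotient (GeodesicRay.setoid X)

/-- Isometries act on geodesic rays by composition. -/
instance GeodesicRay.mulAction (G X : Type*) [Group G] [MetricSpace X] [MulAction G X]
    [IsIsometricSMul G X] : MulAction G (GeodesicRay X) where
  smul g α := ⟨fun t => g • α.1 t, (isometry_smul X g).comp α.2⟩
  one_smul α := Subtype.ext (funext fun t => one_smul G (α.1 t))
  mul_smul g h α := Subtype.ext (funext fun t => mul_smul g h (α.1 t))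

/-- The induced action on the boundary: `g • [α] = [g ∘ α]`. -/
instance VisualBoundary.mulAction (G X : Type*) [Group G] [MetricSpace X] [MulAction G X]
    [IsIsometricSMul G X] : MulAction G (VisualBoundary X) where
  smul g := Quotient.map (fun α : GeodesicRay X => g • α) fun α β ⟨C, hC⟩ =>
    ⟨C, fun t => ((isometry_smul X g).dist_eq (α.1 t) (β.1 t)).trans_le (hC t)⟩
  one_smul a := Quotient.inductionOn a fun α => congrArg (Quotient.mk _) (one_smul G α)
  mul_smul g h a := Quotient.inductionOn a fun α => congrArg (Quotient.mk _) (mul_smul g h α)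

/-- A geometric action: by isometries, proper (for compact `K`, `L` only finitely many translates
of `K` meet `L`), and with compact quotient. -/
class IsGeometricAction (G X : Type*) [Group G] [MetricSpace X] [MulAction G X] : Prop extends
    IsIsometricSMul G X, ProperlyDiscontinuousSMul G X where
  compactSpace_quotient : CompactSpace (MulAction.orbitRel.Quotient G X)

/-- A subgroup `H` of a group acting on `X` is convex if it acts geometrically on some nonempty
closed convex `H`-invariant subset of `X`. -/
def IsConvexSubgroup {G : Type*} (X : Type*) [Group G] [MetricSpace X] [MulAction G X]
    (H : Subgroup G) : Prop :=
  ∃ Y : SubMulAction H X, (Y : Set X).Nonempty ∧ IsClosed (Y : Set X) ∧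
    IsGeodesicallyConvex (Y : Set X) ∧ IsGeometricAction H Y

open Metric

section Comparison

theorem exists_comparison_triangle {X : Type*} [MetricSpace X] (p : Fin 3 → X) :
    ∃ q : Fin 3 → EuclideanSpace ℝ (Fin 2), ∀ i j, dist (q i) (q j) = dist (p i) (p j) := by
  set a := dist (p 0) (p 1) with ha
  set b := dist (p 0) (p 2) with hb
  set c := dist (p 1) (p 2) with hc
  have ha0 : 0 ≤ a := dist_nonneg
  have hb0 : 0 ≤ b := dist_nonneg
  have hc0 : 0 ≤ c := dist_nonneg
  have h1 : a ≤ b + c := by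
    simpa [ha, hb, hc, dist_comm] using dist_triangle (p 0) (p 2) (p 1)
  have h2 : b ≤ a + c := dist_triangle _ _ _
  have h3 : c ≤ a + b := by
    simpa [ha, hb, hc, dist_comm] using dist_triangle (p 1) (p 0) (p 2)
  obtain ⟨u, v, huv, huv'⟩ : ∃ u v : ℝ, u ^ 2 + v ^ 2 = b ^ 2 ∧ (a - u) ^ 2 + v ^ 2 = c ^ 2 := by
    rcases ha0.eq_or_lt with h | h
    · have hbc : b = c := by linarith
      exact ⟨b, 0, by ring, by rw [← h, hbc]; ring⟩
    · set u := (a ^ 2 + b ^ 2 - c ^ 2) / (2 * a) with hu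
      have hu' : 2 * a * u = a ^ 2 + b ^ 2 - c ^ 2 := by rw [hu]; field_simp
      have hub : u ^ 2 ≤ b ^ 2 := by
        refine sq_le_sq' ?_ ?_
        · refine le_of_mul_le_mul_left (a := 2 * a) ?_ (by linarith)
          nlinarith
        · refine le_of_mul_le_mul_left (a := 2 * a) ?_ (by linarith)
          nlinarith
      have hv := Real.sq_sqrt (sub_nonneg.2 hub)
      exact ⟨u, √(b ^ 2 - u ^ 2), by linarith, by rw [hv]; linarith⟩
  refine ⟨![!₂[0, 0], !₂[a, 0], !₂[u, v]], ?_⟩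
  have e01 : dist (!₂[0, 0] : EuclideanSpace ℝ (Fin 2)) !₂[a, 0] = a := by
    simp [EuclideanSpace.dist_eq, Real.dist_eq, Real.sqrt_sq ha0]
  have e02 : dist (!₂[0, 0] : EuclideanSpace ℝ (Fin 2)) !₂[u, v] = b := by
    simp [EuclideanSpace.dist_eq, Real.dist_eq, huv, Real.sqrt_sq hb0]
  have e12 : dist (!₂[a, 0] : EuclideanSpace ℝ (Fin 2)) !₂[u, v] = c := by
    simp [EuclideanSpace.dist_eq, Real.dist_eq, huv', Real.sqrt_sq hc0]
  intro i j
  fin_cases i <;> fin_cases j <;>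
    simp only [Fin.zero_eta, Fin.mk_one, Fin.reduceFinMk, Matrix.cons_val, dist_self, e01, e02, e12,
      dist_comm !₂[a, 0] !₂[(0 : ℝ), 0], dist_comm !₂[u, v] !₂[(0 : ℝ), 0],
      dist_comm !₂[u, v] !₂[a, 0]] <;>
    first | rfl | exact dist_comm _ _

end Comparison

section Geodesics

variable {X : Type*} [MetricSpace X] {x y z w : X} {γ δ : ℝ → X}

theorem IsGeodesicSegment.reverse (h : IsGeodesicSegment γ x y) :
    IsGeodesicSegment (fun t => γ (dist x y - t)) y x where
  dist_eq s hs t ht := by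
    rw [dist_comm y x] at hs ht
    rw [h.dist_eq _ ⟨by linarith [hs.2], by linarith [hs.1]⟩ _
      ⟨by linarith [ht.2], by linarith [ht.1]⟩, abs_sub_comm]
    congr 1
    ring
  source := by simpa using h.target
  target := by simpa [dist_comm y x] using h.source

theorem IsGeodesicSegment.smul {G : Type*} [Group G] [MulAction G X] [IsIsometricSMul G X]
    (h : IsGeodesicSegment γ x y) (g : G) :
    IsGeodesicSegment (fun t => g • γ t) (g • x) (g • y) where
  dist_eq s hs t ht := by
    rw [dist_smul] at hs ht ⊢
    exact h.dist_eq s hs t ht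
  source := by rw [h.source]
  target := by rw [dist_smul, h.target]

/-- Two geodesics issuing from a common point diverge at least linearly. -/
theorem IsCAT0.dist_le_of_common_source (hX : IsCAT0 X) (hγ : IsGeodesicSegment γ x y)
    (hδ : IsGeodesicSegment δ x z) {l : ℝ} (hl : l ∈ Set.Icc (0 : ℝ) 1) :
    dist (γ (l * dist x y)) (δ (l * dist x z)) ≤ l * dist y z := by
  obtain ⟨η, hη⟩ := hX.exists_geodesic y z
  obtain ⟨q, hq⟩ := exists_comparison_triangle ![x, y, z]
  have key := hX.dist_le_comparison ![x, y, z] ![γ, η, fun t => δ (dist x z - t)]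
    (by
      intro i
      fin_cases i
      · exact hγ
      · exact hη
      · exact hδ.reverse) q hq 0 2 (l * dist x y)
    ⟨mul_nonneg hl.1 dist_nonneg, mul_le_of_le_one_left dist_nonneg hl.2⟩ ((1 - l) * dist z x)
    ⟨mul_nonneg (by linarith [hl.2]) dist_nonneg,
      mul_le_of_le_one_left dist_nonneg (by linarith [hl.1])⟩
    (AffineMap.lineMap (q 0) (q 1) l) (by
      rw [segment_eq_image_lineMap]; exact ⟨l, hl, rfl⟩)
    (AffineMap.lineMap (q 2) (q 0) (1 - l)) (by
      rw [segment_eq_image_lineMap]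
      exact ⟨1 - l, ⟨by linarith [hl.2], by linarith [hl.1]⟩, rfl⟩)
    (by
      rw [dist_left_lineMap, hq, Real.norm_of_nonneg hl.1]; rfl)
    (by
      rw [dist_left_lineMap, hq, Real.norm_of_nonneg (by linarith [hl.2])]; rfl)
  have hqyz : dist (q 1) (q 2) = dist y z := hq 1 2
  have hd : dist (AffineMap.lineMap (q 0) (q 1) l : EuclideanSpace ℝ (Fin 2))
      (AffineMap.lineMap (q 2) (q 0) (1 - l)) = l * dist y z := by
    rw [AffineMap.lineMap_apply_one_sub, dist_eq_norm, ← hqyz, dist_eq_norm,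
      AffineMap.lineMap_apply_module, AffineMap.lineMap_apply_module, add_sub_add_left_eq_sub,
      ← smul_sub, norm_smul, Real.norm_of_nonneg hl.1]
  rw [hd] at key
  have e : dist x z - (1 - l) * dist z x = l * dist x z := by rw [dist_comm z x]; ring
  simpa [e] using key

/-- The distance between two geodesics parametrized proportionally to arc length is convex. -/
theorem IsCAT0.dist_le_of_geodesics (hX : IsCAT0 X) (hγ : IsGeodesicSegment γ x y)
    (hδ : IsGeodesicSegment δ z w) {l : ℝ} (hl : l ∈ Set.Icc (0 : ℝ) 1) :
    dist (γ (l * dist x y)) (δ (l * dist z w)) ≤ (1 - l) * dist x z + l * dist y w := by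
  obtain ⟨η, hη⟩ := hX.exists_geodesic x w
  have h1 := hX.dist_le_of_common_source hγ hη hl
  have h2 := hX.dist_le_of_common_source hη.reverse hδ.reverse (l := 1 - l)
    ⟨by linarith [hl.2], by linarith [hl.1]⟩
  have e1 : dist x w - (1 - l) * dist w x = l * dist x w := by rw [dist_comm w x]; ring
  have e2 : dist z w - (1 - l) * dist w z = l * dist z w := by rw [dist_comm w z]; ring
  simp only [e1, e2] at h2
  linarith [dist_triangle (γ (l * dist x y)) (η (l * dist x w)) (δ (l * dist z w))]

end Geodesics

section Displacement

variable {G X : Type*} [Group G] [MetricSpace X] [MulAction G X]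

/-- The points moved by at most `c` by every element of `S`. -/
def displacementSet (X : Type*) [MetricSpace X] [MulAction G X] (S : Set G) (c : ℝ) : Set X :=
  {x | ∀ s ∈ S, dist x (s • x) ≤ c}

theorem isClosed_displacementSet [IsIsometricSMul G X] (S : Set G) (c : ℝ) :
    IsClosed (displacementSet X S c) := by
  simp only [displacementSet, Set.ofPred_forall]
  exact isClosed_iInter fun s => isClosed_iInter fun _ =>
    isClosed_le (continuous_id.dist (isometry_smul X s).continuous) continuous_const

theorem IsCAT0.isGeodesicallyConvex_displacementSet [IsIsometricSMul G X] (hX : IsCAT0 X)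
    (S : Set G) (c : ℝ) : IsGeodesicallyConvex (displacementSet X S c) := by
  intro x hx y hy γ hγ t ht s hs
  rcases dist_nonneg.eq_or_lt (a := (0 : ℝ)) (b := dist x y) with h | h
  · obtain rfl : t = 0 := le_antisymm (ht.2.trans h.ge) ht.1
    rw [hγ.source]
    exact hx s hs
  · have hl : t / dist x y ∈ Set.Icc (0 : ℝ) 1 := ⟨div_nonneg ht.1 h.le, (div_le_one h).2 ht.2⟩
    have key := hX.dist_le_of_geodesics hγ (hγ.smul s) hl
    rw [dist_smul, div_mul_cancel₀ _ h.ne'] at key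
    nlinarith [hx s hs, hy s hs, hl.1, hl.2]

theorem smul_mem_displacementSet [IsIsometricSMul G X] {S : Set G} {c : ℝ} {x : X}
    (hx : x ∈ displacementSet X S c) {g : G} (hg : g ∈ Subgroup.centralizer S) :
    g • x ∈ displacementSet X S c := by
  intro s hs
  rw [smul_smul, Subgroup.mem_centralizer_iff.1 hg s hs, mul_smul, dist_smul]
  exact hx s hs

theorem exists_mem_displacementSet {S : Set G} (hS : S.Finite) (x : X) :
    ∃ c, x ∈ displacementSet X S c := by
  obtain ⟨c, hc⟩ := (hS.image fun s => dist x (s • x)).bddAbove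
  exact ⟨c, fun s hs => hc ⟨s, hs, rfl⟩⟩

end Displacement

section Cobounded

variable {G X : Type*} [Group G] [MetricSpace X] [MulAction G X]

theorem finite_setOf_dist_smul_le [ProperSpace X] [ProperlyDiscontinuousSMul G X] (x : X) (D : ℝ) :
    {g : G | dist x (g • x) ≤ D}.Finite := by
  refine (ProperlyDiscontinuousSMul.finite_disjoint_inter_image (Γ := G)
    (isCompact_singleton (x := x)) (isCompact_closedBall x D)).subset fun g hg => ?_
  exact ⟨g • x, ⟨x, rfl, rfl⟩, by rw [mem_closedBall']; exact hg⟩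

theorem exists_dist_smul_le_of_compactSpace_quotient [IsIsometricSMul G X]
    [CompactSpace (MulAction.orbitRel.Quotient G X)] (x : X) :
    ∃ R, ∀ y : X, ∃ g : G, dist y (g • x) ≤ R := by
  let π : X → MulAction.orbitRel.Quotient G X := Quotient.mk _
  obtain ⟨n, hn⟩ := isCompact_univ.elim_directed_cover (fun n : ℕ => π '' ball x n)
    (fun n => isOpenMap_quotient_mk'_mul _ isOpen_ball)
    (fun q _ => by
      induction q using Quotient.inductionOn with
      | h y =>
        obtain ⟨n, hn⟩ := exists_nat_gt (dist y x)
        exact Set.mem_iUnion.2 ⟨n, y, hn, rfl⟩)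
    (Monotone.directed_le fun m n h => Set.image_mono (ball_subset_ball (by exact_mod_cast h)))
  refine ⟨n, fun y => ?_⟩
  obtain ⟨z, hz, hzy⟩ := hn (Set.mem_univ (π y))
  obtain ⟨g, rfl⟩ := MulAction.orbitRel_apply.1 (Quotient.exact hzy)
  refine ⟨g⁻¹, ?_⟩
  rw [← dist_smul g, smul_inv_smul]
  exact (mem_ball.1 hz).le

/-- The centralizer of a finite set acts coboundedly on its displacement sets. -/
theorem exists_centralizer_dist_smul_le [ProperSpace X] [IsGeometricAction G X] {S : Set G}
    (hS : S.Finite) (c : ℝ) (x : X) : ∃ R, ∀ y ∈ displacementSet X S c, ∃ g ∈ Subgroup.centralizer S,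
      dist y (g • x) ≤ R := by
  have := IsGeometricAction.compactSpace_quotient (G := G) (X := X)
  obtain ⟨R, hR⟩ := exists_dist_smul_le_of_compactSpace_quotient (G := G) x
  have := hS.to_subtype
  let φ : G → S → G := fun g s => g⁻¹ * s * g
  let F : Set (S → G) := Set.univ.pi fun _ => {g : G | dist x (g • x) ≤ 2 * R + c}
  have hF : F.Finite := Set.Finite.pi fun _ => finite_setOf_dist_smul_le x _
  obtain ⟨M, hM⟩ := (hF.image fun τ => dist x (Function.invFun φ τ • x)).bddAbove
  refine ⟨R + M, fun y hy => ?_⟩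
  obtain ⟨g, hg⟩ := hR y
  have hgF : φ g ∈ F := by
    intro s _
    have h1 : dist x (φ g s • x) = dist (g • x) (s.1 • g • x) := by
      rw [← dist_smul g x, smul_smul, smul_smul]
      simp [φ, mul_assoc]
    have h2 : dist (s.1 • y) (s.1 • g • x) ≤ R := by rwa [dist_smul]
    have h3 := hy s s.2
    have h4 := dist_triangle4 (g • x) y (s.1 • y) (s.1 • g • x)
    rw [dist_comm (g • x) y] at h4
    show dist x (φ g s • x) ≤ 2 * R + c
    rw [h1]
    linarith
  set k := Function.invFun φ (φ g) with hk
  have hφ : φ k = φ g := Function.invFun_eq ⟨g, rfl⟩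
  refine ⟨g * k⁻¹, ?_, ?_⟩
  · rw [Subgroup.mem_centralizer_iff]
    intro s hs
    have h := congrFun hφ ⟨s, hs⟩
    simp only [φ] at h
    calc s * (g * k⁻¹) = g * (g⁻¹ * s * g) * k⁻¹ := by group
      _ = g * (k⁻¹ * s * k) * k⁻¹ := by rw [h]
      _ = g * k⁻¹ * s := by group
  · have h1 : dist (g • x) ((g * k⁻¹) • x) ≤ M := by
      rw [mul_smul, dist_smul, ← dist_smul k, smul_inv_smul, dist_comm]
      exact hM ⟨φ g, hgF, rfl⟩
    linarith [dist_triangle y (g • x) ((g * k⁻¹) • x)]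

/-- A subgroup acting properly and coboundedly on a convex subset of a geodesic space is finitely
generated. -/
theorem Subgroup.fg_of_cobounded [ProperSpace X] [IsIsometricSMul G X]
    [ProperlyDiscontinuousSMul G X]
    (hgeo : ∀ x y : X, ∃ γ : ℝ → X, IsGeodesicSegment γ x y) {H : Subgroup G} {Y : Set X}
    (hconv : IsGeodesicallyConvex Y) (hinv : ∀ h ∈ H, ∀ y ∈ Y, h • y ∈ Y) {x : X} (hx : x ∈ Y)
    {R : ℝ} (hR : ∀ y ∈ Y, ∃ h ∈ H, dist y (h • x) ≤ R) : H.FG := by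
  let T : Set G := {h | h ∈ H ∧ dist x (h • x) ≤ 2 * R + 1}
  have hT : T.Finite := (finite_setOf_dist_smul_le x (2 * R + 1)).subset fun _ h => h.2
  have hTH : Subgroup.closure T ≤ H := (Subgroup.closure_le _).2 fun _ h => h.1
  have hstep : ∀ k ∈ Subgroup.closure T, ∀ h ∈ H, dist (k • x) (h • x) ≤ 2 * R + 1 →
      h ∈ Subgroup.closure T := by
    intro k hk h hh hd
    have : k⁻¹ * h ∈ T := by
      refine ⟨H.mul_mem (H.inv_mem (hTH hk)) hh, ?_⟩
      rwa [← dist_smul k, smul_smul, mul_inv_cancel_left]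
    simpa using Subgroup.mul_mem _ hk (Subgroup.subset_closure this)
  have hR0 : 0 ≤ R := by
    obtain ⟨h, -, hh⟩ := hR x hx
    exact dist_nonneg.trans hh
  have hn : ∀ n : ℕ, ∀ y ∈ Y, dist x y ≤ n → ∃ k ∈ Subgroup.closure T, dist y (k • x) ≤ R := by
    intro n
    induction n with
    | zero =>
      intro y _ hd
      obtain rfl : x = y := dist_le_zero.1 (by simpa using hd)
      exact ⟨1, Subgroup.one_mem _, by simpa using hR0⟩
    | succ n ih =>
      intro y hy hd
      push_cast at hd
      obtain ⟨γ, hγ⟩ := hgeo x y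
      have h0 : (0 : ℝ) ∈ Set.Icc 0 (dist x y) := ⟨le_rfl, dist_nonneg⟩
      have h1 : dist x y ∈ Set.Icc 0 (dist x y) := ⟨dist_nonneg, le_rfl⟩
      have hm : min (n : ℝ) (dist x y) ∈ Set.Icc 0 (dist x y) :=
        ⟨le_min (Nat.cast_nonneg n) dist_nonneg, min_le_right _ _⟩
      have hxm := hγ.dist_eq _ h0 _ hm
      have hmy := hγ.dist_eq _ hm _ h1
      rw [hγ.source, zero_sub, abs_neg, abs_of_nonneg hm.1] at hxm
      rw [hγ.target, abs_sub_comm, abs_of_nonneg (by linarith [hm.2])] at hmy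
      obtain ⟨k, hk, hkd⟩ := ih _ (hconv x hx y hy γ hγ _ hm) (hxm.trans_le (min_le_left _ _))
      obtain ⟨h, hh, hhd⟩ := hR y hy
      refine ⟨h, hstep k hk h hh ?_, hhd⟩
      have hle : dist x y - min (n : ℝ) (dist x y) ≤ 1 := by
        rcases min_choice (n : ℝ) (dist x y) with e | e <;> rw [e] <;> linarith
      have h4 := dist_triangle4 (h • x) y (γ (min (n : ℝ) (dist x y))) (k • x)
      rw [dist_comm (h • x) y, dist_comm y (γ _)] at h4
      rw [dist_comm (k • x) (h • x)]
      linarith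
  refine ⟨hT.toFinset, ?_⟩
  rw [hT.coe_toFinset]
  refine le_antisymm hTH fun h hh => ?_
  obtain ⟨n, hn'⟩ := exists_nat_ge (dist x (h • x))
  obtain ⟨k, hk, hkd⟩ := hn n (h • x) (hinv h hh x hx) hn'
  exact hstep k hk h hh (by rw [dist_comm]; linarith)

/-- A subgroup acting coboundedly on a closed convex subset is convex. -/
theorem IsConvexSubgroup.of_cobounded [ProperSpace X] [IsIsometricSMul G X]
    [ProperlyDiscontinuousSMul G X]
    {H : Subgroup G} {Y : Set X} (hclosed : IsClosed Y) (hconv : IsGeodesicallyConvex Y)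
    (hinv : ∀ h ∈ H, ∀ y ∈ Y, h • y ∈ Y) {x : X} (hx : x ∈ Y)
    {R : ℝ} (hR : ∀ y ∈ Y, ∃ h ∈ H, dist y (h • x) ≤ R) : IsConvexSubgroup X H := by
  let Y' : SubMulAction H X := ⟨Y, fun h {y} hy => hinv h h.2 y hy⟩
  refine ⟨Y', ⟨x, hx⟩, hclosed, hconv, ?_⟩
  have hiso : IsIsometricSMul H Y' :=
    ⟨fun h => Isometry.of_dist_eq fun a b => dist_smul (h : G) (a : X) (b : X)⟩
  have hpd : ProperlyDiscontinuousSMul H Y' := by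
    refine ⟨fun {K L} hK hL => ?_⟩
    refine Set.Finite.of_finite_image (f := Subtype.val) ?_ Subtype.val_injective.injOn
    refine (ProperlyDiscontinuousSMul.finite_disjoint_inter_image (Γ := G)
      (hK.image continuous_subtype_val) (hL.image continuous_subtype_val)).subset ?_
    rintro _ ⟨h, hh, rfl⟩
    obtain ⟨_, ⟨a, ha, rfl⟩, hb⟩ := hh
    exact ⟨((h • a : Y') : X), ⟨a, ⟨a, ha, rfl⟩, rfl⟩, ⟨h • a, hb, rfl⟩⟩
  refine { hiso, hpd with compactSpace_quotient := ⟨?_⟩ }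
  have hK : IsCompact ((↑) ⁻¹' closedBall x R : Set Y') :=
    hclosed.isClosedEmbedding_subtypeVal.isCompact_preimage (isCompact_closedBall x R)
  convert hK.image (f := (Quotient.mk _ : Y' → MulAction.orbitRel.Quotient H Y'))
    continuous_quotient_mk' using 1
  symm
  rw [Set.eq_univ_iff_forall]
  intro q
  induction q using Quotient.inductionOn with
  | h y =>
    obtain ⟨h, hh, hd⟩ := hR y y.2
    refine ⟨(⟨h, hh⟩ : H)⁻¹ • y, ?_, Quotient.sound ⟨(⟨h, hh⟩ : H)⁻¹, rfl⟩⟩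
    show dist (h⁻¹ • (y : X)) x ≤ R
    rwa [← dist_smul h, smul_inv_smul]

end Cobounded

section Centralizers

variable {G X : Type*} [Group G] [MetricSpace X] [ProperSpace X] [MulAction G X]
  [IsGeometricAction G X]

theorem Subgroup.FG.exists_finite_centralizer_eq {G : Type*} [Group G] {H : Subgroup G}
    (hH : H.FG) : ∃ S : Set G, S.Finite ∧ S ⊆ H ∧
      Subgroup.centralizer S = Subgroup.centralizer (H : Set G) := by
  obtain ⟨S, rfl⟩ := hH
  exact ⟨S, S.finite_toSet, Subgroup.subset_closure, (Subgroup.centralizer_closure _).symm⟩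

theorem IsCAT0.centralizer_fg [Nonempty X] (hX : IsCAT0 X) {H : Subgroup G} (hH : H.FG) :
    (Subgroup.centralizer (H : Set G)).FG := by
  obtain ⟨S, hS, -, hSH⟩ := hH.exists_finite_centralizer_eq
  obtain ⟨x⟩ := ‹Nonempty X›
  obtain ⟨c, hc⟩ := exists_mem_displacementSet hS x
  obtain ⟨R, hR⟩ := exists_centralizer_dist_smul_le hS c x
  rw [← hSH]
  exact Subgroup.fg_of_cobounded hX.exists_geodesic
    (hX.isGeodesicallyConvex_displacementSet S c)
    (fun _ hh _ hy => smul_mem_displacementSet hy hh) hc hR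

theorem IsCAT0.isConvexSubgroup_centralizer [Nonempty X] (hX : IsCAT0 X) {H : Subgroup G}
    (hH : H.FG) : IsConvexSubgroup X (Subgroup.centralizer (H : Set G)) := by
  obtain ⟨S, hS, -, hSH⟩ := hH.exists_finite_centralizer_eq
  obtain ⟨x⟩ := ‹Nonempty X›
  obtain ⟨c, hc⟩ := exists_mem_displacementSet hS x
  obtain ⟨R, hR⟩ := exists_centralizer_dist_smul_le hS c x
  rw [← hSH]
  exact IsConvexSubgroup.of_cobounded (isClosed_displacementSet S c)
    (hX.isGeodesicallyConvex_displacementSet S c)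
    (fun _ hh _ hy => smul_mem_displacementSet hy hh) hc hR

/-- A boundary point fixed by a finitely generated subgroup is fixed by its double centralizer. -/
theorem smul_eq_of_mem_centralizer_centralizer {H : Subgroup G} (hH : H.FG)
    {a : VisualBoundary X} (ha : ∀ h ∈ H, h • a = a) {g : G}
    (hg : g ∈ Subgroup.centralizer (Subgroup.centralizer (H : Set G) : Set G)) : g • a = a := by
  obtain ⟨S, hS, hSub, hSH⟩ := hH.exists_finite_centralizer_eq
  induction a using Quotient.inductionOn with
  | h α =>
    have hb : ∀ s ∈ S, ∃ C : ℝ, ∀ t, dist (s • α.1 t) (α.1 t) ≤ C :=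
      fun s hs => Quotient.exact (ha s (hSub hs))
    choose! C hC using hb
    obtain ⟨c, hc⟩ := (hS.image C).bddAbove
    have hα : ∀ t, α.1 t ∈ displacementSet X S c := fun t s hs => by
      rw [dist_comm]
      exact (hC s hs t).trans (hc ⟨s, hs, rfl⟩)
    obtain ⟨R, hR⟩ := exists_centralizer_dist_smul_le hS c (α.1 0)
    refine Quotient.sound ⟨2 * R + dist (g • α.1 0) (α.1 0), fun t => ?_⟩
    obtain ⟨z, hz, hd⟩ := hR _ (hα t)
    have hcomm : g • z • α.1 0 = z • g • α.1 0 := by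
      rw [smul_smul, smul_smul, Subgroup.mem_centralizer_iff.1 hg z (hSH ▸ hz)]
    have h4 := dist_triangle4 (g • α.1 t) (g • z • α.1 0) (z • α.1 0) (α.1 t)
    rw [dist_smul, dist_comm (z • α.1 0) (α.1 t)] at h4
    rw [hcomm, dist_smul] at h4
    show dist (g • α.1 t) (α.1 t) ≤ _
    linarith

end Centralizers

theorem mainTheorem12 {G X : Type*} [Group G] [MetricSpace X] [ProperSpace X] [Nonempty X]
    (hX : IsCAT0 X) [MulAction G X] [IsGeometricAction G X] (A : Set (VisualBoundary X))
    (hA : (fixingSubgroup G A).FG) :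
    IsConvexSubgroup X (fixingSubgroup G A) ∧
      Subgroup.centralizer (Subgroup.centralizer (fixingSubgroup G A : Set G) : Set G) =
        fixingSubgroup G A := by
  have key : Subgroup.centralizer (Subgroup.centralizer (fixingSubgroup G A : Set G) : Set G) =
      fixingSubgroup G A := by
    refine le_antisymm (fun g hg => ?_) (Subgroup.le_centralizer_iff.1 le_rfl)
    exact (mem_fixingSubgroup_iff G).2 fun a ha => smul_eq_of_mem_centralizer_centralizer hA
      (fun h hh => (mem_fixingSubgroup_iff G).1 hh a ha) hg
  refine ⟨?_, key⟩
  have h := hX.isConvexSubgroup_centralizer (hX.centralizer_fg hA)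
  rwa [key] at h
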